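/- Let $S(x)=\frac{\sin \pi x}{\pi x}$ for $x\ne 0$ and $S(0)=1$. For $a>0$ let $a\mathbb{Z}=\{\dots,-a,0,a,\dots\}$, and let $\mathrm{Conf}(a\mathbb{Z})$ be the set of locally finite configurations in $a\mathbb{Z}$, i.e. of sequences $u=(u_j)_{j\in\mathbb{Z}}$ in $a\mathbb{Z}$ such that $\{j: u_j\in K\}$ is finite for every compact interval $K$. Give $\mathrm{Conf}(a\mathbb{Z})$ the Borel $\sigma$-algebra of the topology generated by the sets $\{u : \#\{j: u_j=x\}=n\}$, for $x\in a\mathbb{Z}$ and $n=0,1,2,\dots$. A point process on $a\mathbb{Z}$ is a random element of $\mathrm{Conf}(a\mathbb{Z})$. (i) For each $0<a\le 1$ there exists a point process $(w_j)_{j\in\mathbb{Z}}$ on $a\mathbb{Z}$ such that for all $n\ge 1$ and all $\varphi\in C_c(\mathbb{R}^n)$ (continuous, compactly supported, complex-valued) the following expectation exists and $$\mathbb{E}\sum_{\substack{j_1,\dots,j_n\in\mathbb{Z}\\ \text{distinct}}}\varphi(w_{j_1},\dots,w_{j_n}) = a^n\sum_{k\in(a\mathbb{Z})^n}\varphi(k)\,\det_{1\le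 i,j\le n}\big[S(k_i-k_j)\big].$$ In other words, its $n$-point correlation functions with respect to $a^n$ times counting measure are $\det[S(k_i-k_j)]$. (ii) For $a>1$ there is no point process on $a\mathbb{Z}$ with this property. -/

import Mathlib

open MeasureTheory

/-- The lattice `aℤ = {…, -a, 0, a, …} ⊆ ℝ`. -/
abbrev ScaledInts (a : ℝ) : Type := AddSubgroup.zmultiples a

/-- Locally finite configurations in `aℤ`: sequences `(u_j)`, `j ∈ ℤ`, of points of `aℤ` (repetitions
allowed) with finitely many indices in every compact interval. -/
structure Conf (a : ℝ) where
  /-- the `j`-th point of the configuration -/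
  point : ℤ → ScaledInts a
  locallyFinite : ∀ s t : ℝ, {j : ℤ | (point j : ℝ) ∈ Set.Icc s t}.Finite

namespace Conf

variable {a : ℝ}

/-- The number of members of the configuration `u` that lie in `V`, counted with multiplicity. -/
noncomputable def count (u : Conf a) (V : Set (ScaledInts a)) : ℕ∞ :=
  {j : ℤ | u.point j ∈ V}.encard

/-- The topology generated by the cylinder sets `{u | #_{x}(u) = n}`. -/
instance : TopologicalSpace (Conf a) :=
  TopologicalSpace.generateFrom
    {C | ∃ (n : ℕ) (x : ScaledInts a), C = {u : Conf a | u.count {x} = n}}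

instance : MeasurableSpace (Conf a) := borel (Conf a)

instance : BorelSpace (Conf a) := ⟨rfl⟩

/-- The sum of `φ (u_{j_1}, …, u_{j_n})` over all `n`-tuples of pairwise distinct indices. It has
only finitely many nonzero terms when `φ` has compact support. -/
noncomputable def distinctSum (u : Conf a) {n : ℕ} (φ : (Fin n → ℝ) → ℂ) : ℂ :=
  ∑' j : Fin n ↪ ℤ, φ fun i => (u.point (j i) : ℝ)

end Conf

/-- `w` is a point process on `aℤ` over the probability space `(Ω, P)`: a random element of
`Conf a`. -/
structure IsPointProcess {a : ℝ} {Ω : Type*} [MeasurableSpace Ω] (P : Measure Ω)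
    (w : Ω → Conf a) : Prop where
  isProbabilityMeasure : IsProbabilityMeasure P
  measurable : Measurable w

/-- `ρ` is the `n`-point correlation function of `w`, with respect to `a ^ n` times the counting
measure on `(aℤ)ⁿ`: for every `φ ∈ C_c(ℝⁿ)` the expectation of the sum over distinct
`n`-tuples exists and equals `aⁿ ∑_{k ∈ (aℤ)ⁿ} φ(k) ρ(k)` (a sum with finitely many nonzero
terms when `0 < a`). -/
def IsCorrelationFunction {a : ℝ} {Ω : Type*} [MeasurableSpace Ω] (P : Measure Ω)
    (w : Ω → Conf a) (n : ℕ) (ρ : (Fin n → ScaledInts a) → ℝ) : Prop :=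
  ∀ φ : (Fin n → ℝ) → ℂ, Continuous φ → HasCompactSupport φ →
    Integrable (fun ω => (w ω).distinctSum φ) P ∧
    ∫ ω, (w ω).distinctSum φ ∂P =
      (a : ℂ) ^ n * ∑' k : Fin n → ScaledInts a, φ (fun i => (k i : ℝ)) * (ρ k : ℂ)

/-- `S(x) = sin (π x) / (π x)` for `x ≠ 0`, and `S(0) = 1`. -/
noncomputable def sineKernel (x : ℝ) : ℝ := Real.sinc (Real.pi * x)

/-- `w` is an `a`-discrete sine process: a point process on `aℤ` whose `n`-point correlation
functions are `det [S(k_i - k_j)]`, for all `n ≥ 1`. -/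
structure IsDiscreteSineProcess {a : ℝ} {Ω : Type*} [MeasurableSpace Ω] (P : Measure Ω)
    (w : Ω → Conf a) : Prop extends IsPointProcess P w where
  correlation : ∀ n : ℕ, 1 ≤ n → IsCorrelationFunction P w n fun k =>
    Matrix.det (Matrix.of fun i j : Fin n => sineKernel ((k i : ℝ) - (k j : ℝ)))

/-! With respect to counting measure on `aℤ` the kernel is `K(k,l) = a S(k-l)`. On the Fourier side
it cuts off to frequencies in `[-1/2, 1/2]`, while the dual period of `aℤ` is `[-1/(2a), 1/(2a)]`.
For `a ≤ 1` the first interval lies in the second, so `0 ≤ K ≤ 1` as quadratic forms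
(`sum_kernel_nonneg`, `sum_kernel_le`). Such a `K` defines a determinantal process: on a finite set
the point probabilities are explicit determinants, nonnegative and of total 1, and a weak limit by
compactness gives a random subset of the whole lattice (`exists_determinantal`). A configuration is
indexed by all of `ℤ`, so this subset must also be infinite almost surely, which follows from a
variance bound (`ae_infinite_of_pair_le`). For `a > 1`, let `N` be the multiplicity of the origin.
The correlations force `E N = a` and `E N(N-1) = 0`, against `N ≤ 1 + N(N-1)`. -/

open Filter Topology Finset

/-! ### Determinants that mix rows of `K` and `1 - K`. -/

namespace Matrix

/-- A real matrix, not necessarily symmetric, whose quadratic form is nonnegative has nonnegative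
determinant. -/
theorem det_nonneg_of_dotProduct_mulVec_nonneg {n : Type*} [Fintype n] [DecidableEq n]
    (M : Matrix n n ℝ) (hM : ∀ x : n → ℝ, 0 ≤ x ⬝ᵥ M *ᵥ x) : 0 ≤ M.det := by
  by_contra! hneg
  -- Along the segment from `M` to the identity the quadratic form is positive definite for `t > 0`,
  -- so the determinant cannot change sign.
  set g : ℝ → ℝ := fun t => (t • (1 : Matrix n n ℝ) + (1 - t) • M).det with hg
  have hcont : Continuous g := by
    apply Continuous.matrix_det
    fun_prop
  have h0 : g 0 < 0 := by simpa [hg] using hneg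
  have h1 : 0 < g 1 := by simp [hg]
  obtain ⟨t, ht, hgt⟩ := intermediate_value_Icc zero_le_one hcont.continuousOn
    (show (0 : ℝ) ∈ Set.Icc (g 0) (g 1) from ⟨h0.le, h1.le⟩)
  have ht0 : 0 < t := by
    rcases ht.1.lt_or_eq with h | h
    · exact h
    · rw [← h] at hgt
      exact absurd hgt h0.ne
  obtain ⟨v, hv, hMv⟩ := exists_mulVec_eq_zero_iff.mpr hgt
  have hpos : 0 < v ⬝ᵥ v := by
    refine lt_of_le_of_ne (Finset.sum_nonneg fun i _ => mul_self_nonneg _) fun h => hv ?_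
    exact dotProduct_self_eq_zero.mp h.symm
  have hz : v ⬝ᵥ (t • (1 : Matrix n n ℝ) + (1 - t) • M) *ᵥ v = 0 := by rw [hMv]; simp
  rw [add_mulVec, smul_mulVec, smul_mulVec, one_mulVec, dotProduct_add, dotProduct_smul,
    dotProduct_smul, smul_eq_mul, smul_eq_mul] at hz
  nlinarith [mul_pos ht0 hpos, mul_nonneg (sub_nonneg.mpr ht.2) (hM v)]

variable {ι : Type*} [Fintype ι] [DecidableEq ι]

/-- The matrix with the rows of `M` at the indices in `s` and the rows of `N` elsewhere. -/
def rowPiecewise (s : Finset ι) (M N : Matrix ι ι ℝ) : Matrix ι ι ℝ :=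
  Matrix.of fun i j => if i ∈ s then M i j else N i j

/-- The rows of `K` with index in `s` together with the rows of `1 - K` with index outside `s`.
Its determinant is the probability that the determinantal process with kernel `K` is equal to `s`. -/
def selectRows (K : Matrix ι ι ℝ) (s : Finset ι) : Matrix ι ι ℝ :=
  rowPiecewise s K (1 - K)

/-- Split `x = p + q` along `s`. By symmetry of `K` the cross terms cancel, leaving the form of `K`
at `p` plus that of `1 - K` at `q`. -/
theorem det_selectRows_nonneg {K : Matrix ι ι ℝ} (hK : K.IsSymm)
    (h0 : ∀ x : ι → ℝ, 0 ≤ x ⬝ᵥ K *ᵥ x) (h1 : ∀ x : ι → ℝ, x ⬝ᵥ K *ᵥ x ≤ x ⬝ᵥ x)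
    (s : Finset ι) : 0 ≤ (K.selectRows s).det := by
  refine det_nonneg_of_dotProduct_mulVec_nonneg _ fun x => ?_
  set p : ι → ℝ := fun i => if i ∈ s then x i else 0 with hp
  set q : ι → ℝ := fun i => if i ∈ s then 0 else x i with hq
  have hx : x = p + q := by
    ext i; by_cases hi : i ∈ s <;> simp [hp, hq, hi]
  have hpq : q ⬝ᵥ p = 0 := by
    refine Finset.sum_eq_zero fun i _ => ?_
    by_cases hi : i ∈ s <;> simp [hp, hq, hi]
  have hsel : x ⬝ᵥ K.selectRows s *ᵥ x = p ⬝ᵥ K *ᵥ x + q ⬝ᵥ (1 - K) *ᵥ x := by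
    simp only [dotProduct, ← Finset.sum_add_distrib]
    refine Finset.sum_congr rfl fun i _ => ?_
    by_cases hi : i ∈ s <;>
      simp [hp, hq, hi, selectRows, rowPiecewise, mulVec, dotProduct, Matrix.sub_apply]
  have hsymm : p ⬝ᵥ K *ᵥ q = q ⬝ᵥ K *ᵥ p := by
    rw [dotProduct_mulVec, ← mulVec_transpose, hK.eq, dotProduct_comm]
  have hval : x ⬝ᵥ K.selectRows s *ᵥ x = p ⬝ᵥ K *ᵥ p + (q ⬝ᵥ q - q ⬝ᵥ K *ᵥ q) := by
    rw [hsel, hx]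
    simp only [mulVec_add, sub_mulVec, one_mulVec, dotProduct_add, dotProduct_sub]
    linarith
  rw [hval]
  linarith [h0 p, h1 q]

/-- Multilinear expansion: a row outside `A` is `K + (1 - K)`, a row in `A` is `K + 0`, so sets `s`
not containing `A` contribute zero. -/
theorem sum_det_selectRows_of_subset (K : Matrix ι ι ℝ) (A : Finset ι) :
    ∑ s : Finset ι, (if A ⊆ s then (K.selectRows s).det else 0) =
      (rowPiecewise A K 1).det := by
  have key := (detRowAlternating (R := ℝ) (n := ι)).map_add_univ (fun i => K i)
    (fun i => if i ∈ A then 0 else (1 - K) i)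
  have hadd : ((fun i => K i) + fun i => if i ∈ A then 0 else (1 - K) i) =
      fun i => rowPiecewise A K 1 i := by
    funext i j
    by_cases hi : i ∈ A <;> simp [hi, rowPiecewise]
  rw [hadd] at key
  refine Eq.trans (Finset.sum_congr rfl fun s _ => ?_) key.symm
  split_ifs with h
  · refine congrArg (detRowAlternating (R := ℝ) (n := ι)) ?_
    funext i j
    by_cases hi : i ∈ s
    · simp [selectRows, rowPiecewise, hi]
    · have hA : i ∉ A := fun hA => hi (h hA)
      simp [selectRows, rowPiecewise, hi, hA]
  · obtain ⟨i, hiA, his⟩ := Finset.not_subset.mp h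
    symm
    apply (detRowAlternating (R := ℝ) (n := ι)).map_coord_zero i
    simp [hiA, his]

theorem det_rowPiecewise_one (K : Matrix ι ι ℝ) {n : ℕ} {k : Fin n → ι}
    (hk : Function.Injective k) :
    (rowPiecewise (univ.image k) K 1).det = (K.submatrix k k).det := by
  rw [twoBlockTriangular_det _ (fun i => i ∈ Set.range k)]
  · have h1 : (toSquareBlockProp (rowPiecewise (univ.image k) K 1)
        fun i => ¬ i ∈ Set.range k) = 1 := by
      ext i j
      have hi : (i : ι) ∉ univ.image k := by simpa using i.2
      simp only [toSquareBlockProp_def, rowPiecewise, Matrix.of_apply, if_neg hi,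
        Matrix.one_apply, Subtype.ext_iff]
    have h2 : (toSquareBlockProp (rowPiecewise (univ.image k) K 1)
        fun i => i ∈ Set.range k).submatrix (Equiv.ofInjective k hk) (Equiv.ofInjective k hk) =
          K.submatrix k k := by
      ext i j
      simp [toSquareBlockProp, rowPiecewise]
    rw [h1, det_one, mul_one, ← h2]
    convert (det_submatrix_equiv_self (Equiv.ofInjective k hk) _).symm
  · intro i hi j hj
    have hi' : i ∉ univ.image k := by simpa using hi
    have hij : i ≠ j := fun h => hi (h ▸ hj)
    simp only [rowPiecewise, Matrix.of_apply, if_neg hi', Matrix.one_apply_ne hij]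

theorem sum_det_selectRows (K : Matrix ι ι ℝ) : ∑ s : Finset ι, (K.selectRows s).det = 1 := by
  have h : rowPiecewise ∅ K 1 = 1 := by ext; simp [rowPiecewise]
  simpa [h] using K.sum_det_selectRows_of_subset ∅

end Matrix

/-! ### Existence of determinantal processes. -/

/-- Determinantal processes on a finite subset `Λ` of a possibly infinite set. -/
theorem exists_determinantal_on_finset {ι : Type*} (K : Matrix ι ι ℝ)
    (hK : K.IsSymm) (Λ : Finset ι)
    (h0 : ∀ x : ι → ℝ, 0 ≤ ∑ i ∈ Λ, ∑ j ∈ Λ, x i * K i j * x j)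
    (h1 : ∀ x : ι → ℝ, ∑ i ∈ Λ, ∑ j ∈ Λ, x i * K i j * x j ≤ ∑ i ∈ Λ, x i ^ 2) :
    ∃ μ : ProbabilityMeasure (ι → Bool), ∀ (n : ℕ) (k : Fin n → ι), Function.Injective k →
      (∀ i, k i ∈ Λ) →
      (μ : Measure (ι → Bool)).real {ω | ∀ i, ω (k i) = true} = (K.submatrix k k).det := by
  classical
  set L : Matrix Λ Λ ℝ := K.submatrix (↑) (↑) with hL
  have hquad (x : Λ → ℝ) : x ⬝ᵥ L.mulVec x =
      ∑ i ∈ Λ, ∑ j ∈ Λ, (fun i => if h : i ∈ Λ then x ⟨i, h⟩ else 0) i * K i j *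
        (fun i => if h : i ∈ Λ then x ⟨i, h⟩ else 0) j := by
    rw [← Finset.sum_coe_sort Λ]
    refine Finset.sum_congr rfl fun i _ => ?_
    rw [← Finset.sum_coe_sort Λ, Matrix.mulVec, dotProduct, Finset.mul_sum]
    refine Finset.sum_congr rfl fun j _ => ?_
    simp [hL, mul_assoc]
  have hsq (x : Λ → ℝ) : x ⬝ᵥ x =
      ∑ i ∈ Λ, (fun i => if h : i ∈ Λ then x ⟨i, h⟩ else 0) i ^ 2 := by
    rw [← Finset.sum_coe_sort Λ]
    exact Finset.sum_congr rfl fun i _ => by simp [sq]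
  have hpos : ∀ s, 0 ≤ (L.selectRows s).det := Matrix.det_selectRows_nonneg
    (hK.submatrix _) (fun x => hquad x ▸ h0 _) (fun x => hquad x ▸ hsq x ▸ h1 _)
  set ν : Measure (ι → Bool) := ∑ s : Finset Λ, ENNReal.ofReal (L.selectRows s).det •
    Measure.dirac (fun i => decide (∃ h : i ∈ Λ, (⟨i, h⟩ : Λ) ∈ s)) with hν
  have hprob : IsProbabilityMeasure ν := by
    constructor
    simp only [hν, Measure.coe_finsetSum, Finset.sum_apply, Measure.smul_apply, measure_univ,
      smul_eq_mul, mul_one]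
    rw [← ENNReal.ofReal_sum_of_nonneg fun s _ => hpos s, L.sum_det_selectRows,
      ENNReal.ofReal_one]
  refine ⟨⟨ν, hprob⟩, fun n k hk hkΛ => ?_⟩
  set k' : Fin n → Λ := fun i => ⟨k i, hkΛ i⟩ with hk'
  have hk'inj : Function.Injective k' := fun i j h => hk (congrArg Subtype.val h)
  have hmeas : MeasurableSet {ω : ι → Bool | ∀ i, ω (k i) = true} := by
    rw [Set.ofPred_forall]
    exact MeasurableSet.iInter fun i =>
      (measurableSet_singleton true).preimage (measurable_pi_apply (k i))
  have hsub : K.submatrix k k = L.submatrix k' k' := by ext; simp [hL, hk']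
  have hterm (s : Finset Λ) :
      0 ≤ if univ.image k' ⊆ s then (L.selectRows s).det else 0 := by
    split_ifs <;> simp [hpos]
  rw [hsub, ← Matrix.det_rowPiecewise_one L hk'inj, ← Matrix.sum_det_selectRows_of_subset,
    measureReal_def, ← ENNReal.toReal_ofReal (Finset.sum_nonneg fun s _ => hterm s),
    ENNReal.ofReal_sum_of_nonneg fun s _ => hterm s]
  congr 1
  simp only [hν, ProbabilityMeasure.coe_mk, Measure.coe_finsetSum, Finset.sum_apply,
    Measure.smul_apply, smul_eq_mul]
  refine Finset.sum_congr rfl fun s _ => ?_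
  rw [Measure.dirac_apply' _ hmeas]
  by_cases h : univ.image k' ⊆ s
  · have : ∀ i, k' i ∈ s := fun i => h (Finset.mem_image_of_mem _ (Finset.mem_univ i))
    rw [if_pos h, Set.indicator_of_mem]
    · simp
    · simpa [hkΛ] using this
  · rw [if_neg h, Set.indicator_of_notMem]
    · simp
    · contrapose! h
      simpa [Finset.image_subset_iff, hkΛ] using h

/-- A real symmetric kernel on a countable set with `0 ≤ K ≤ 1` is the correlation kernel of a
determinantal process. -/
theorem exists_determinantal {ι : Type*} [Countable ι] (K : Matrix ι ι ℝ) (hK : K.IsSymm)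
    (h0 : ∀ (Λ : Finset ι) (x : ι → ℝ), 0 ≤ ∑ i ∈ Λ, ∑ j ∈ Λ, x i * K i j * x j)
    (h1 : ∀ (Λ : Finset ι) (x : ι → ℝ),
      ∑ i ∈ Λ, ∑ j ∈ Λ, x i * K i j * x j ≤ ∑ i ∈ Λ, x i ^ 2) :
    ∃ μ : ProbabilityMeasure (ι → Bool), ∀ (n : ℕ) (k : Fin n → ι), Function.Injective k →
      (μ : Measure (ι → Bool)).real {ω | ∀ i, ω (k i) = true} = (K.submatrix k k).det := by
  classical
  choose m hm using fun Λ => exists_determinantal_on_finset K hK Λ (h0 Λ) (h1 Λ)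
  let : MetricSpace (ι → Bool) := TopologicalSpace.metrizableSpaceMetric _
  -- The measures `m Λ` are chosen independently, with no consistency between them; a cluster point
  -- suffices, since each cylinder probability is eventually constant in `Λ`.
  set U : Ultrafilter (ProbabilityMeasure (ι → Bool)) := Ultrafilter.of (atTop.map m) with hU
  obtain ⟨μ, -, hμ⟩ := isCompact_univ.ultrafilter_le_nhds U (by simp)
  refine ⟨μ, fun n k hk => ?_⟩
  -- A clopen event has empty frontier, so its probability passes to the weak limit.
  have hclopen : IsClopen {ω : ι → Bool | ∀ i, ω (k i) = true} := by
    rw [Set.ofPred_forall]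
    exact isClopen_iInter_of_finite fun i =>
      (isClopen_discrete {true}).preimage (continuous_apply (k i))
  have hlim := ProbabilityMeasure.tendsto_measure_of_null_frontier_of_tendsto'
    (μs := id) (L := (U : Filter (ProbabilityMeasure (ι → Bool)))) hμ
    (E := {ω : ι → Bool | ∀ i, ω (k i) = true}) (by rw [hclopen.frontier_eq, measure_empty])
  have hev : ∀ᶠ ν : ProbabilityMeasure (ι → Bool) in U,
      ENNReal.ofReal (K.submatrix k k).det =
        (ν : Measure (ι → Bool)) {ω | ∀ i, ω (k i) = true} := by
    refine Ultrafilter.of_le (atTop.map m) ?_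
    rw [Filter.mem_map]
    filter_upwards [eventually_ge_atTop (univ.image k)] with Λ hΛ
    rw [← hm Λ n k hk fun i => hΛ (Finset.mem_image_of_mem _ (Finset.mem_univ i))]
    exact ofReal_measureReal
  have hdet : 0 ≤ (K.submatrix k k).det := by
    rw [← hm (univ.image k) n k hk fun i => Finset.mem_image_of_mem _ (Finset.mem_univ i)]
    exact measureReal_nonneg
  rw [measureReal_def, tendsto_nhds_unique hlim (tendsto_const_nhds.congr' hev),
    ENNReal.toReal_ofReal hdet]

/-! ### Fourier bounds for the sine kernel on the lattice. -/

theorem integral_cos_mul_symm (r R : ℝ) :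
    ∫ θ in (-R)..R, Real.cos (r * θ) = 2 * R * Real.sinc (r * R) := by
  rcases eq_or_ne r 0 with rfl | hr
  · simp; ring
  rcases eq_or_ne R 0 with rfl | hR
  · simp
  rw [intervalIntegral.integral_comp_mul_left _ hr, integral_cos,
    Real.sinc_of_ne_zero (mul_ne_zero hr hR)]
  simp only [mul_neg, Real.sin_neg, smul_eq_mul]
  field_simp
  ring

/-- Fourier representation of the quadratic form of the kernel `sinc`. -/
theorem sum_sinc_eq_integral {ι : Type*} (Λ : Finset ι) (t x : ι → ℝ) (R : ℝ) :
    ∑ i ∈ Λ, ∑ j ∈ Λ, x i * (2 * R * Real.sinc ((t i - t j) * R)) * x j =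
      ∫ θ in (-R)..R, ((∑ i ∈ Λ, x i * Real.cos (t i * θ)) ^ 2 +
        (∑ i ∈ Λ, x i * Real.sin (t i * θ)) ^ 2) := by
  have h (θ : ℝ) : (∑ i ∈ Λ, x i * Real.cos (t i * θ)) ^ 2 +
      (∑ i ∈ Λ, x i * Real.sin (t i * θ)) ^ 2 =
        ∑ i ∈ Λ, ∑ j ∈ Λ, x i * x j * Real.cos ((t i - t j) * θ) := by
    simp only [sq, Finset.sum_mul_sum, ← Finset.sum_add_distrib]
    refine Finset.sum_congr rfl fun i _ => Finset.sum_congr rfl fun j _ => ?_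
    rw [sub_mul, Real.cos_sub]
    ring
  simp only [h]
  have hint (i j : ι) : IntervalIntegrable
      (fun θ => x i * x j * Real.cos ((t i - t j) * θ)) volume (-R) R :=
    (by fun_prop : Continuous _).intervalIntegrable _ _
  rw [intervalIntegral.integral_finsetSum fun i _ =>
    (by fun_prop : Continuous _).intervalIntegrable _ _]
  refine Finset.sum_congr rfl fun i _ => ?_
  rw [intervalIntegral.integral_finsetSum fun j _ => hint i j]
  refine Finset.sum_congr rfl fun j _ => ?_
  rw [intervalIntegral.integral_const_mul, integral_cos_mul_symm]
  ring

/-- The Fourier integrand is nonnegative and does not depend on `R`; only the interval grows. -/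
theorem sum_sinc_mono {ι : Type*} (Λ : Finset ι) (t x : ι → ℝ) {R R' : ℝ} (hR : 0 ≤ R)
    (hRR' : R ≤ R') :
    ∑ i ∈ Λ, ∑ j ∈ Λ, x i * (2 * R * Real.sinc ((t i - t j) * R)) * x j ≤
      ∑ i ∈ Λ, ∑ j ∈ Λ, x i * (2 * R' * Real.sinc ((t i - t j) * R')) * x j := by
  rw [sum_sinc_eq_integral, sum_sinc_eq_integral]
  refine intervalIntegral.integral_mono_interval (by linarith) (by linarith) hRR' ?_
    ((by fun_prop : Continuous _).intervalIntegrable _ _)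
  exact Filter.Eventually.of_forall fun θ => by positivity

namespace ScaledInts

variable {a : ℝ}

instance : Countable (ScaledInts a) :=
  Function.Surjective.countable (f := fun m : ℤ => (⟨m • a, m, rfl⟩ : ScaledInts a))
    fun ⟨_, m, hm⟩ => ⟨m, Subtype.ext hm⟩

/-- The correlation kernel of the `a`-discrete sine process, with respect to counting measure. -/
noncomputable def kernel (a : ℝ) : Matrix (ScaledInts a) (ScaledInts a) ℝ :=
  Matrix.of fun k l => a * sineKernel ((k : ℝ) - (l : ℝ))

theorem kernel_isSymm : (kernel a).IsSymm := by
  ext k l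
  simp only [kernel, sineKernel, Matrix.transpose_apply, Matrix.of_apply]
  rw [← neg_sub, mul_neg, Real.sinc_neg]

theorem kernel_self (k : ScaledInts a) : kernel a k k = a := by
  simp [kernel, sineKernel]

theorem sum_kernel (a : ℝ) (Λ : Finset (ScaledInts a)) (x : ScaledInts a → ℝ) :
    ∑ i ∈ Λ, ∑ j ∈ Λ, x i * kernel a i j * x j =
      a * ∑ i ∈ Λ, ∑ j ∈ Λ, x i *
        (2 * (1 / 2) * Real.sinc ((2 * Real.pi * (i : ℝ) - 2 * Real.pi * (j : ℝ)) * (1 / 2))) *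
          x j := by
  simp only [Finset.mul_sum]
  refine Finset.sum_congr rfl fun i _ => Finset.sum_congr rfl fun j _ => ?_
  rw [show (2 * Real.pi * (i : ℝ) - 2 * Real.pi * (j : ℝ)) * (1 / 2) =
    Real.pi * ((i : ℝ) - (j : ℝ)) by ring]
  simp only [kernel, sineKernel, Matrix.of_apply]
  ring

theorem sum_kernel_nonneg (ha : 0 ≤ a) (Λ : Finset (ScaledInts a)) (x : ScaledInts a → ℝ) :
    0 ≤ ∑ i ∈ Λ, ∑ j ∈ Λ, x i * kernel a i j * x j := by
  rw [sum_kernel]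
  refine mul_nonneg ha ?_
  simpa using sum_sinc_mono Λ (fun i : ScaledInts a => 2 * Real.pi * (i : ℝ)) x le_rfl
    (by norm_num : (0 : ℝ) ≤ 1 / 2)

/-- Enlarge the frequency interval from half-length `1/2` to `1/(2a)`, a full dual period. There
distinct characters are orthogonal and the form becomes exactly `∑ x i ^ 2`. -/
theorem sum_kernel_le (ha : 0 < a) (ha1 : a ≤ 1) (Λ : Finset (ScaledInts a))
    (x : ScaledInts a → ℝ) :
    ∑ i ∈ Λ, ∑ j ∈ Λ, x i * kernel a i j * x j ≤ ∑ i ∈ Λ, x i ^ 2 := by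
  classical
  have hR : (1 / 2 : ℝ) ≤ 1 / (2 * a) := by
    apply one_div_le_one_div_of_le <;> linarith
  have hmono := sum_sinc_mono Λ (fun i : ScaledInts a => 2 * Real.pi * (i : ℝ)) x
    (by norm_num : (0 : ℝ) ≤ 1 / 2) hR
  have horth (i j : ScaledInts a) : Real.sinc ((2 * Real.pi * (i : ℝ) - 2 * Real.pi * (j : ℝ)) *
      (1 / (2 * a))) = if i = j then 1 else 0 := by
    split_ifs with h
    · simp [h]
    obtain ⟨m, hm⟩ := AddSubgroup.mem_zmultiples_iff.mp (i - j).2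
    have hm' : (m : ℝ) * a = (i : ℝ) - (j : ℝ) := by simpa using hm
    have hm0 : m ≠ 0 := by
      rintro rfl
      exact h (Subtype.ext (by simpa [sub_eq_zero] using hm'.symm))
    have harg : (2 * Real.pi * (i : ℝ) - 2 * Real.pi * (j : ℝ)) * (1 / (2 * a)) = m * Real.pi := by
      rw [← mul_sub, ← hm']
      field_simp
    rw [harg, Real.sinc_of_ne_zero (by positivity), Real.sin_int_mul_pi, zero_div]
  rw [sum_kernel]
  refine (mul_le_mul_of_nonneg_left hmono ha.le).trans_eq ?_
  rw [Finset.mul_sum]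
  refine Finset.sum_congr rfl fun i hi => ?_
  simp only [horth, mul_ite, ite_mul, mul_one, mul_zero, zero_mul, Finset.sum_ite_eq, hi, if_true]
  field_simp

theorem finite_mem_of_isCompact {C : Set ℝ} (hC : IsCompact C) :
    {k : ScaledInts a | (k : ℝ) ∈ C}.Finite := by
  have := AddSubgroup.tendsto_zmultiples_subtype_cofinite a hC.compl_mem_cocompact
  rw [Filter.mem_map, Filter.mem_cofinite, ← Set.preimage_compl, compl_compl] at this
  exact this

theorem finite_support_of_hasCompactSupport {n : ℕ} {φ : (Fin n → ℝ) → ℂ}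
    (hφ : HasCompactSupport φ) :
    (Function.support fun k : Fin n → ScaledInts a => φ fun i => (k i : ℝ)).Finite := by
  refine (Set.Finite.pi fun i : Fin n => finite_mem_of_isCompact (a := a)
    (hφ.image (continuous_apply i))).subset fun k hk i _ => ?_
  exact ⟨_, subset_tsupport _ hk, rfl⟩

theorem infinite (ha : 0 < a) : Infinite (ScaledInts a) := by
  refine Infinite.of_injective (fun m : ℤ => (⟨m • a, m, rfl⟩ : ScaledInts a)) fun m m' h => ?_
  have h' : (m : ℝ) * a = m' * a := by simpa using congrArg Subtype.val h
  exact_mod_cast mul_right_cancel₀ ha.ne' h'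

end ScaledInts

/-! ### Almost sure infinitude by the second moment. -/

/-- A random set with constant intensity and no positively correlated pairs is almost surely
infinite. -/
theorem ae_infinite_of_pair_le {ι : Type*} [Infinite ι] {μ : Measure (ι → Bool)}
    [IsProbabilityMeasure μ] {p : ℝ} (hp : 0 < p)
    (h1 : ∀ k, μ.real {ω | ω k = true} = p)
    (h2 : ∀ k l, k ≠ l → μ.real {ω | ω k = true ∧ ω l = true} ≤ p ^ 2) :
    ∀ᵐ ω ∂μ, {k | ω k = true}.Infinite := by
  classical
  set e : ι → (ι → Bool) → ℝ := fun k => {ω : ι → Bool | ω k = true}.indicator 1 with he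
  have hset (k : ι) : MeasurableSet {ω : ι → Bool | ω k = true} :=
    (measurableSet_singleton true).preimage (measurable_pi_apply k)
  have hmul (k l : ι) : (fun ω => e k ω * e l ω) =
      {ω : ι → Bool | ω k = true ∧ ω l = true}.indicator 1 := by
    ext ω
    by_cases hk : ω k = true <;> by_cases hl : ω l = true <;> simp [he, hk, hl]
  have hint1 (k : ι) : Integrable (e k) μ := (integrable_const 1).indicator (hset k)
  have hint2 (k l : ι) : Integrable (fun ω => e k ω * e l ω) μ := by
    rw [hmul]
    exact (integrable_const 1).indicator ((hset k).inter (hset l))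
  have hE1 (k : ι) : ∫ ω, e k ω ∂μ = p := by
    rw [← h1 k, ← integral_indicator_one (hset k)]
  -- The spare `p ^ 2` on the diagonal makes the double sum cancel the squared mean, so the variance
  -- is at most `p * #F`.
  have hE2 (k l : ι) : ∫ ω, e k ω * e l ω ∂μ ≤ (if k = l then p else 0) + p ^ 2 := by
    have hval : ∫ ω, e k ω * e l ω ∂μ = μ.real {ω | ω k = true ∧ ω l = true} := by
      rw [hmul]
      exact integral_indicator_one ((hset k).inter (hset l))
    rw [hval]
    split_ifs with h
    · subst h
      simp only [and_self, h1]
      nlinarith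
    · simpa using h2 k l h
  have hvar (F : Finset ι) : ∫ ω, (∑ k ∈ F, e k ω - p * #F) ^ 2 ∂μ ≤ p * #F := by
    have hexp (ω : ι → Bool) : (∑ k ∈ F, e k ω - p * #F) ^ 2 =
        ∑ k ∈ F, ∑ l ∈ F, e k ω * e l ω - 2 * p * #F * ∑ k ∈ F, e k ω + (p * #F) ^ 2 := by
      rw [← Finset.sum_mul_sum]
      ring
    have hi2 : Integrable (fun ω => ∑ k ∈ F, ∑ l ∈ F, e k ω * e l ω) μ :=
      integrable_finsetSum _ fun k _ => integrable_finsetSum _ fun l _ => hint2 k l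
    have hi1 : Integrable (fun ω => 2 * p * #F * ∑ k ∈ F, e k ω) μ :=
      (integrable_finsetSum _ fun k _ => hint1 k).const_mul _
    simp only [hexp]
    rw [integral_add (by exact hi2.sub hi1) (integrable_const _), integral_sub hi2 hi1,
      integral_finsetSum _ fun k _ => integrable_finsetSum _ fun l _ => hint2 k l,
      integral_const_mul, integral_finsetSum _ fun k _ => hint1 k]
    simp only [hE1, integral_const, probReal_univ, one_smul, Finset.sum_const, nsmul_eq_mul]
    have : ∑ k ∈ F, ∫ ω, ∑ l ∈ F, e k ω * e l ω ∂μ ≤ ∑ k ∈ F, (p + #F * p ^ 2) := by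
      refine Finset.sum_le_sum fun k hk => ?_
      rw [integral_finsetSum _ fun l _ => hint2 k l]
      refine (Finset.sum_le_sum fun l _ => hE2 k l).trans_eq ?_
      simp [Finset.sum_add_distrib, hk]
    rw [Finset.sum_const, nsmul_eq_mul] at this
    nlinarith
  have hbound (C : ℕ) : μ {ω | ∀ F : Finset ι, ∑ k ∈ F, e k ω ≤ C} = 0 := by
    set B := {ω | ∀ F : Finset ι, ∑ k ∈ F, e k ω ≤ C}
    -- Chebyshev: on `B` the count is at most `C < p * N / 2`, hence at least `p * N / 2` below its
    -- mean.
    have hN (N : ℕ) (hNC : 2 * C + 1 ≤ p * N) : μ.real B * (p * N) ≤ 4 := by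
      obtain ⟨F, -, hF⟩ := (Set.infinite_univ (α := ι)).exists_subset_card_eq N
      have hmarkov := mul_meas_ge_le_integral_of_nonneg (μ := μ)
        (f := fun ω => (∑ k ∈ F, e k ω - p * #F) ^ 2)
        (Filter.Eventually.of_forall fun ω => sq_nonneg _) ?_ ((p * N / 2) ^ 2)
      · have hle : μ.real B ≤ μ.real {ω | (p * N / 2) ^ 2 ≤ (∑ k ∈ F, e k ω - p * #F) ^ 2} := by
          refine measureReal_mono fun ω hω => ?_
          have := hω F
          simp only [Set.mem_ofPred_eq, hF]
          nlinarith
        have hv := hvar F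
        rw [hF] at hv hmarkov hle
        have hpN : 0 < p * N := by
          have : (0 : ℝ) ≤ C := by positivity
          linarith
        have := mul_le_mul_of_nonneg_left hle (sq_nonneg (p * N / 2))
        have h4 : (p * N) * (μ.real B * (p * N)) ≤ (p * N) * 4 := by nlinarith
        exact le_of_mul_le_mul_left h4 hpN
      · refine MemLp.integrable_sq (MemLp.sub ?_ (memLp_const _))
        exact memLp_finsetSum _ fun k _ => (memLp_const 1).indicator (hset k)
    have hzero : μ.real B = 0 := by
      by_contra hne
      have hpos : 0 < μ.real B := lt_of_le_of_ne measureReal_nonneg (Ne.symm hne)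
      obtain ⟨N, hNgt⟩ := exists_nat_gt ((2 * C + 1) / p + 4 / (μ.real B * p))
      have hA : (2 * C + 1) / p < N := lt_of_le_of_lt (le_add_of_nonneg_right (by positivity)) hNgt
      have hB : 4 / (μ.real B * p) < N :=
        lt_of_le_of_lt (le_add_of_nonneg_left (by positivity)) hNgt
      rw [div_lt_iff₀ (by positivity)] at hA hB
      have := hN N (by linarith)
      linarith
    exact (measureReal_eq_zero_iff).mp hzero
  have hall : ∀ᵐ ω ∂μ, ∀ C : ℕ, ¬ ∀ F : Finset ι, ∑ k ∈ F, e k ω ≤ C := by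
    rw [ae_all_iff]
    intro C
    rw [ae_iff]
    simpa only [not_not] using hbound C
  filter_upwards [hall] with ω hω hfin
  refine hω #(hfin.toFinset) fun F => ?_
  have : ∑ k ∈ F, e k ω = #(F.filter fun k => ω k = true) := by
    simp [he, Set.indicator_apply, Finset.sum_boole]
  rw [this]
  exact_mod_cast Finset.card_le_card fun k hk => by simpa using (Finset.mem_filter.mp hk).2

/-! ### Configurations without repeated points. -/

namespace Conf

variable {a : ℝ}

theorem exists_of_infinite {X : Set (ScaledInts a)} (hX : X.Infinite) :
    ∃ u : Conf a, Function.Injective u.point ∧ Set.range u.point = X := by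
  have := hX.to_subtype
  obtain ⟨e⟩ := nonempty_equiv_of_countable (α := ℤ) (β := X)
  have hinj : Function.Injective fun j => (e j : ScaledInts a) :=
    Subtype.val_injective.comp e.injective
  refine ⟨⟨fun j => e j, fun s t => ?_⟩, hinj, ?_⟩
  · exact (ScaledInts.finite_mem_of_isCompact (isCompact_Icc (a := s) (b := t))).preimage
      (f := fun j => (e j : ScaledInts a)) hinj.injOn
  · change Set.range (Subtype.val ∘ e) = X
    rw [e.surjective.range_comp, Subtype.range_coe]

open Classical in
theorem count_singleton_of_injective {u : Conf a} (hu : Function.Injective u.point)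
    (x : ScaledInts a) : u.count {x} = if x ∈ Set.range u.point then 1 else 0 := by
  unfold count
  split_ifs with h
  · obtain ⟨j, rfl⟩ := h
    rw [Set.encard_eq_one]
    exact ⟨j, by ext i; simp [hu.eq_iff]⟩
  · rw [Set.encard_eq_zero, Set.eq_empty_iff_forall_notMem]
    exact fun j hj => h ⟨j, hj⟩

/-- There are countably many cylinder sets, so they generate the Borel σ-algebra and not only the
topology. -/
theorem measurable_of_measurableSet_count {Ω : Type*} [MeasurableSpace Ω] {w : Ω → Conf a}
    (h : ∀ (n : ℕ) (x : ScaledInts a), MeasurableSet {ω | (w ω).count {x} = n}) :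
    Measurable w := by
  set G : Set (Set (Conf a)) :=
    {C | ∃ (n : ℕ) (x : ScaledInts a), C = {u : Conf a | u.count {x} = n}} with hG
  have hcount : G.Countable := by
    refine (Set.countable_range fun q : ℕ × ScaledInts a =>
      {u : Conf a | u.count {q.2} = q.1}).mono ?_
    rintro _ ⟨n, x, rfl⟩
    exact ⟨(n, x), rfl⟩
  have : SecondCountableTopology (Conf a) := ⟨⟨G, hcount, rfl⟩⟩
  have hborel : borel (Conf a) = MeasurableSpace.generateFrom G :=
    borel_eq_generateFrom_of_subbasis rfl
  rw [BorelSpace.measurable_eq (α := Conf a), hborel]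
  refine measurable_generateFrom ?_
  rintro _ ⟨n, x, rfl⟩
  exact h n x

open Classical in
-- Without multiplicities, tuples of distinct indices correspond to tuples of distinct points;
-- compact support makes the sum finite over a set independent of `u`.
theorem distinctSum_of_injective {u : Conf a} (hu : Function.Injective u.point) {n : ℕ}
    {φ : (Fin n → ℝ) → ℂ} (hφ : HasCompactSupport φ) :
    u.distinctSum φ = ∑ k ∈ (ScaledInts.finite_support_of_hasCompactSupport (a := a) hφ).toFinset,
      if Function.Injective k ∧ ∀ i, k i ∈ Set.range u.point then φ fun i => (k i : ℝ) else 0 := by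
  set f : (Fin n → ScaledInts a) → ℂ := fun k =>
    if Function.Injective k ∧ ∀ i, k i ∈ Set.range u.point then φ fun i => (k i : ℝ) else 0 with hf
  have hg : Function.Injective fun (j : Fin n ↪ ℤ) (i : Fin n) => u.point (j i) :=
    fun j j' h => DFunLike.ext _ _ fun i => hu (congrFun h i)
  have hsupp : Function.support f ⊆
      Set.range fun (j : Fin n ↪ ℤ) (i : Fin n) => u.point (j i) := by
    intro k hk
    have hk' : Function.Injective k ∧ ∀ i, k i ∈ Set.range u.point := by
      by_contra hcon
      exact hk (if_neg hcon)
    choose j hj using hk'.2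
    refine ⟨⟨j, fun i i' h => hk'.1 ?_⟩, funext hj⟩
    rw [← hj i, ← hj i', h]
  have h1 : u.distinctSum φ = ∑' k, f k := by
    rw [← hg.tsum_eq hsupp]
    refine tsum_congr fun j => ?_
    rw [hf]
    simp only
    rw [if_pos ⟨hu.comp j.injective, fun i => ⟨_, rfl⟩⟩]
  rw [h1]
  refine tsum_eq_sum fun k hk => ?_
  have : φ (fun i => (k i : ℝ)) = 0 := by simpa using hk
  simp [hf, this]

end Conf

/-! ### Existence for `a ≤ 1`. -/

theorem ScaledInts.det_kernel_submatrix {a : ℝ} {n : ℕ} (k : Fin n → ScaledInts a) :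
    ((ScaledInts.kernel a).submatrix k k).det =
      a ^ n * (Matrix.of fun i j : Fin n => sineKernel ((k i : ℝ) - (k j : ℝ))).det := by
  have : (ScaledInts.kernel a).submatrix k k =
      a • Matrix.of fun i j : Fin n => sineKernel ((k i : ℝ) - (k j : ℝ)) := by
    ext i j
    simp [ScaledInts.kernel]
  rw [this, Matrix.det_smul, Fintype.card_fin]

theorem ScaledInts.exists_measure {a : ℝ} (ha : 0 < a) (ha1 : a ≤ 1) :
    ∃ μ : Measure (ScaledInts a → Bool), IsProbabilityMeasure μ ∧
      (∀ᵐ ω ∂μ, {k | ω k = true}.Infinite) ∧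
      ∀ (n : ℕ) (k : Fin n → ScaledInts a), Function.Injective k →
        μ.real {ω | ∀ i, ω (k i) = true} = ((ScaledInts.kernel a).submatrix k k).det := by
  obtain ⟨μ, hμ⟩ := exists_determinantal (ScaledInts.kernel a) ScaledInts.kernel_isSymm
    (ScaledInts.sum_kernel_nonneg ha.le) (ScaledInts.sum_kernel_le ha ha1)
  refine ⟨μ, inferInstance, ?_, hμ⟩
  have := ScaledInts.infinite ha
  refine ae_infinite_of_pair_le ha (fun k => ?_) fun k l hkl => ?_
  · have h := hμ 1 (fun _ => k) (Function.injective_of_subsingleton _)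
    simpa [ScaledInts.kernel_self] using h
  -- The pair probability is `a ^ 2 - K(k,l) ^ 2`.
  · have h := hμ 2 ![k, l] (by
      intro i j
      fin_cases i <;> fin_cases j <;> simp [hkl, hkl.symm])
    have hsymm : ScaledInts.kernel a l k = ScaledInts.kernel a k l :=
      ScaledInts.kernel_isSymm.apply k l
    rw [Matrix.det_fin_two] at h
    simp only [Fin.forall_fin_two, Matrix.submatrix_apply, Matrix.cons_val_zero,
      Matrix.cons_val_one, ScaledInts.kernel_self, hsymm] at h
    rw [h]
    nlinarith [mul_self_nonneg (ScaledInts.kernel a k l)]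

theorem exists_isDiscreteSineProcess {a : ℝ} (ha : 0 < a) (ha1 : a ≤ 1) :
    ∃ (P : Measure (ScaledInts a → Bool)) (w : (ScaledInts a → Bool) → Conf a),
      IsDiscreteSineProcess P w := by
  classical
  obtain ⟨μ, hprob, hinf, hμ⟩ := ScaledInts.exists_measure ha ha1
  have := ScaledInts.infinite ha
  -- On the null event of finitely many points the whole lattice serves as a default value.
  have hw (ω : ScaledInts a → Bool) : ∃ u : Conf a, Function.Injective u.point ∧
      Set.range u.point = if {k | ω k = true}.Infinite then {k | ω k = true} else Set.univ := by
    refine Conf.exists_of_infinite ?_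
    split_ifs with h
    exacts [h, Set.infinite_univ]
  choose w hwinj hwrange using hw
  have hset (k : ScaledInts a) : MeasurableSet {ω : ScaledInts a → Bool | ω k = true} :=
    (measurableSet_singleton true).preimage (measurable_pi_apply k)
  have hinfset : MeasurableSet {ω : ScaledInts a → Bool | {k | ω k = true}.Infinite} := by
    have heq : {ω : ScaledInts a → Bool | {k | ω k = true}.Infinite} =
        ⋂ F : Finset (ScaledInts a), ⋃ k ∈ (F : Set (ScaledInts a))ᶜ, {ω | ω k = true} := by
      ext ω
      simp only [Set.mem_ofPred_eq, Set.mem_iInter, Set.mem_iUnion, exists_prop]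
      refine ⟨fun h F => ?_, fun h hfin => ?_⟩
      · obtain ⟨k, hk, hkF⟩ := h.exists_notMem_finset F
        exact ⟨k, by simpa using hkF, hk⟩
      · obtain ⟨k, hkF, hk⟩ := h hfin.toFinset
        exact hkF (by rw [Set.Finite.coe_toFinset]; exact hk)
    rw [heq]
    exact MeasurableSet.iInter fun F => .biUnion (Set.to_countable _) fun k _ => hset k
  have hmem (x : ScaledInts a) : MeasurableSet {ω | x ∈ Set.range (w ω).point} := by
    have heq : {ω | x ∈ Set.range (w ω).point} =
        ({ω | ω x = true} ∪ {ω | {k | ω k = true}.Infinite}ᶜ) := by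
      ext ω
      rw [Set.mem_ofPred_eq, hwrange]
      split_ifs with h <;> simp [h]
    rw [heq]
    exact (hset x).union hinfset.compl
  refine ⟨μ, w, ⟨hprob, Conf.measurable_of_measurableSet_count fun n x => ?_⟩, fun n _ φ _ hφ => ?_⟩
  · have heq : {ω | (w ω).count {x} = n} =
        ({ω | x ∈ Set.range (w ω).point} ∩ {_ω | (1 : ℕ∞) = n}) ∪
          ({ω | x ∈ Set.range (w ω).point}ᶜ ∩ {_ω | (0 : ℕ∞) = n}) := by
      ext ω
      rw [Set.mem_ofPred_eq, Conf.count_singleton_of_injective (hwinj ω)]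
      simp only [Set.mem_union, Set.mem_inter_iff, Set.mem_compl_iff, Set.mem_ofPred_eq]
      split_ifs with h <;> simp only [h, true_and, false_and, not_true, not_false_iff, or_false,
        false_or]
    rw [heq]
    exact ((hmem x).inter (.const _)).union ((hmem x).compl.inter (.const _))
  set F := (ScaledInts.finite_support_of_hasCompactSupport (a := a) hφ).toFinset with hF
  -- Tuples with a repeated point can be dropped: their determinant has two equal rows.
  set g : (Fin n → ScaledInts a) → (ScaledInts a → Bool) → ℂ := fun k =>
    {ω | ∀ i, ω (k i) = true}.indicator fun _ =>
      if Function.Injective k then φ fun i => (k i : ℝ) else 0 with hg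
  have hksets (k : Fin n → ScaledInts a) :
      MeasurableSet {ω : ScaledInts a → Bool | ∀ i, ω (k i) = true} := by
    rw [Set.ofPred_forall]
    exact MeasurableSet.iInter fun i => hset (k i)
  have hgint (k : Fin n → ScaledInts a) : Integrable (g k) μ :=
    (integrable_const _).indicator (hksets k)
  have hae : (fun ω => (w ω).distinctSum φ) =ᵐ[μ] fun ω => ∑ k ∈ F, g k ω := by
    filter_upwards [hinf] with ω hω
    rw [Conf.distinctSum_of_injective (hwinj ω) hφ]
    refine Finset.sum_congr rfl fun k _ => ?_
    rw [hwrange ω, if_pos hω]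
    by_cases h1 : Function.Injective k <;> by_cases h2 : ∀ i, ω (k i) = true <;>
      simp [hg, h1, h2]
  refine ⟨(integrable_finsetSum _ fun k _ => hgint k).congr hae.symm, ?_⟩
  rw [integral_congr_ae hae, integral_finsetSum _ fun k _ => hgint k, ← tsum_mul_left,
    tsum_eq_sum (s := F)]
  · refine Finset.sum_congr rfl fun k _ => ?_
    rw [hg]
    simp only
    rw [integral_indicator_const _ (hksets k)]
    split_ifs with hk
    · rw [hμ n k hk, ScaledInts.det_kernel_submatrix, Complex.real_smul]
      push_cast
      ring
    · obtain ⟨i, j, hij, hne⟩ := Function.not_injective_iff.mp hk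
      rw [Matrix.det_zero_of_row_eq hne]
      · simp
      · funext l
        simp [hij]
  · intro k hk
    have : φ (fun i => (k i : ℝ)) = 0 := by simpa [hF] using hk
    simp [this]

/-! ### Nonexistence for `a > 1`. -/

/-- The tensor power of the tent function: it is `1` at the origin and vanishes outside the
open unit cube. -/
noncomputable def tent (n : ℕ) (y : Fin n → ℝ) : ℂ :=
  ∏ i, ((max 0 (1 - |y i|) : ℝ) : ℂ)

theorem continuous_tent (n : ℕ) : Continuous (tent n) := by
  unfold tent
  fun_prop

theorem tent_eq_zero {n : ℕ} {y : Fin n → ℝ} {i : Fin n} (hi : 1 ≤ |y i|) : tent n y = 0 := by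
  refine Finset.prod_eq_zero (Finset.mem_univ i) ?_
  rw [max_eq_left (by linarith), Complex.ofReal_zero]

theorem tent_eq_one {n : ℕ} {y : Fin n → ℝ} (hy : ∀ i, y i = 0) : tent n y = 1 := by
  simp [tent, hy]

theorem hasCompactSupport_tent (n : ℕ) : HasCompactSupport (tent n) := by
  refine HasCompactSupport.intro (isCompact_univ_pi fun _ : Fin n => isCompact_Icc (a := (-1 : ℝ))
    (b := 1)) fun y hy => ?_
  simp only [Set.mem_pi, Set.mem_univ, true_implies, not_forall] at hy
  obtain ⟨i, hi⟩ := hy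
  refine tent_eq_zero (i := i) ?_
  rw [Set.mem_Icc, ← abs_le, not_le] at hi
  exact hi.le

theorem ScaledInts.one_le_abs {a : ℝ} (ha : 1 ≤ a) {k : ScaledInts a} (hk : k ≠ 0) :
    1 ≤ |(k : ℝ)| := by
  obtain ⟨m, hm⟩ := AddSubgroup.mem_zmultiples_iff.mp k.2
  have hm0 : m ≠ 0 := by
    rintro rfl
    exact hk (Subtype.ext (by simpa using hm.symm))
  have h1 : (1 : ℝ) ≤ |(m : ℝ)| := by exact_mod_cast Int.one_le_abs hm0
  rw [← hm, zsmul_eq_mul, abs_mul, abs_of_pos (by linarith : 0 < a)]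
  nlinarith

/-- For `a ≥ 1` the open unit cube meets the lattice only at the origin, so the sum counts ordered
tuples of distinct indices there. `N` is the multiplicity of the origin, the same for all `n`. -/
theorem Conf.distinctSum_tent {a : ℝ} (ha : 1 ≤ a) (u : Conf a) :
    ∃ N : ℕ, ∀ n, u.distinctSum (tent n) = N.descFactorial n := by
  set J : Set ℤ := {j | u.point j = 0} with hJ
  have hfin : J.Finite := by
    refine (u.locallyFinite 0 0).subset fun j hj => ?_
    have : u.point j = 0 := hj
    simp [this]
  have := hfin.fintype
  refine ⟨Fintype.card J, fun n => ?_⟩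
  have hg : Function.Injective fun j : Fin n ↪ J => j.trans (Function.Embedding.subtype _) :=
    fun j j' h => by
      ext i
      exact congrArg (fun f : Fin n ↪ ℤ => f i) h
  have hsupp : Function.support (fun j : Fin n ↪ ℤ => tent n fun i => (u.point (j i) : ℝ)) ⊆
      Set.range fun j : Fin n ↪ J => j.trans (Function.Embedding.subtype _) := by
    intro j hj
    have hmem (i : Fin n) : j i ∈ J := by
      by_contra hi
      exact hj (tent_eq_zero (i := i) (ScaledInts.one_le_abs ha hi))
    exact ⟨⟨fun i => ⟨j i, hmem i⟩, fun i i' h => j.injective (congrArg Subtype.val h)⟩, rfl⟩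
  rw [Conf.distinctSum, ← hg.tsum_eq hsupp, tsum_fintype, Finset.sum_congr rfl
    fun j _ => tent_eq_one fun i => by
      have : u.point (j i) = 0 := (j i).2
      simp [this]]
  rw [Finset.sum_const, Finset.card_univ, Fintype.card_embedding_eq, Fintype.card_fin,
    nsmul_eq_mul, mul_one]

theorem not_isDiscreteSineProcess {a : ℝ} (ha : 1 < a) {Ω : Type*} [MeasurableSpace Ω]
    (P : Measure Ω) (w : Ω → Conf a) : ¬ IsDiscreteSineProcess P w := by
  intro h
  have := h.isProbabilityMeasure
  have hsum (n : ℕ) (hn : 1 ≤ n) : ∫ ω, (w ω).distinctSum (tent n) ∂P =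
      (a : ℂ) ^ n * ((Matrix.of fun _ _ : Fin n => (1 : ℝ)).det : ℂ) := by
    rw [(h.correlation n hn (tent n) (continuous_tent n) (hasCompactSupport_tent n)).2,
      tsum_eq_single (0 : Fin n → ScaledInts a)]
    · rw [tent_eq_one fun i => by simp]
      simp [sineKernel]
    · intro k hk
      obtain ⟨i, hi⟩ := Function.ne_iff.mp hk
      rw [tent_eq_zero (i := i) (ScaledInts.one_le_abs ha.le hi), zero_mul]
  have hint (n : ℕ) (hn : 1 ≤ n) : Integrable (fun ω => (w ω).distinctSum (tent n)) P :=
    (h.correlation n hn (tent n) (continuous_tent n) (hasCompactSupport_tent n)).1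
  have hre (n : ℕ) (hn : 1 ≤ n) : ∫ ω, ((w ω).distinctSum (tent n)).re ∂P =
      a ^ n * (Matrix.of fun _ _ : Fin n => (1 : ℝ)).det := by
    have := integral_re (𝕜 := ℂ) (hint n hn)
    simp only [RCLike.re_eq_complex_re] at this
    rw [this, hsum n hn]
    exact_mod_cast Complex.ofReal_re _
  -- Integrating `N ≤ 1 + N(N-1)` gives `a ≤ 1`, because the `2 × 2` all-ones determinant vanishes.
  have hle : ∫ ω, ((w ω).distinctSum (tent 1)).re ∂P ≤
      ∫ ω, (1 + ((w ω).distinctSum (tent 2)).re) ∂P := by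
    refine integral_mono (hint 1 le_rfl).re ((integrable_const 1).add (hint 2 one_le_two).re)
      fun ω => ?_
    obtain ⟨N, hN⟩ := (w ω).distinctSum_tent ha.le
    have hNat : N.descFactorial 1 ≤ 1 + N.descFactorial 2 := by
      rcases N with _ | _ | N
      · simp
      · simp
      · simp only [Nat.descFactorial_succ, Nat.descFactorial_zero]
        norm_num
        nlinarith
    simp only [hN, Complex.natCast_re]
    exact_mod_cast hNat
  have hadd := integral_add (integrable_const (μ := P) (1 : ℝ)) (hint 2 one_le_two).re
  simp only [RCLike.re_eq_complex_re] at hadd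
  rw [hadd, hre 1 le_rfl] at hle
  have h2 := hre 2 one_le_two
  simp only [Matrix.det_fin_two, Matrix.of_apply, mul_one, sub_self, mul_zero] at h2
  rw [h2] at hle
  simp at hle
  linarith

theorem proposition4p2 :
    (∀ a : ℝ, 0 < a → a ≤ 1 →
      ∃ (Ω : Type) (_ : MeasurableSpace Ω) (P : Measure Ω) (w : Ω → Conf a),
        IsDiscreteSineProcess P w) ∧
    (∀ a : ℝ, 1 < a →
      ∀ (Ω : Type*) [MeasurableSpace Ω] (P : Measure Ω) (w : Ω → Conf a),
        ¬ IsDiscreteSineProcess P w) := by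
  refine ⟨fun a ha ha1 => ?_, fun a ha Ω _ P w => not_isDiscreteSineProcess ha P w⟩
  obtain ⟨P, w, h⟩ := exists_isDiscreteSineProcess ha ha1
  exact ⟨_, _, P, w, h⟩
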